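/- For each $p\in\mathbb N$ let $W_i=W_{i}^{(p)}$ be a random vector in $\mathbb R^p$ with square-integrable entries and let $\gamma=\gamma^{(p)}\in\mathbb R^p$ be non-random. All limits are taken as $p\to\infty$. Suppose that the eigenvalues of $E[W_iW_i']$ are bounded away from zero and infinity (uniformly over all large $p$) and that $\|\gamma\|_2\asymp 1$. Let $\mathcal R$ be distributed according to the Haar probability measure on $SO(p)=\{A\in\mathbb R^{p\times p}: A'A=I_p,\ \det A=1\}$. For $s\in\mathbb N$ and $C\in\mathbb R$ let $$A_p(s,C)=P\Bigl(\min_{\|v\|_0\le s}E\bigl[(W_i'\gamma-(\mathcal R W_i)'v)^2\mid\mathcal R\bigr]\le C\,\tfrac{s}{p}\Bigr),$$ where $\|v\|_0$ is the number of non-zero entries of $v\in\mathbb R^p$ and the conditional expectation is taken over $W_i$ with $\mathcal R$ held fixed. Call a sequence $s=(s_p)$ of non-negative integers a sparsity index if $s_p=o(\sqrt p/\log p)$. Then the logarithm of the probability that the model with regressor $\mathcal R W_i$ is approximately sparse, i.e. that the minimum above is $O(s_p/p)$ for a sparsity index $s$, is of exact order $-\frac p4\log p$, in the following sense. (i) For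 every sparsity index $s$, every $C$ and every $\varepsilon>0$, $\log A_p(s_p,C)\le-(1-\varepsilon)\frac p4\log p$ for all large enough $p$ (with $\log 0=-\infty$). (ii) There is a sparsity index $s$ such that for every $C>0$, $\log A_p(s_p,C)=-(1+o(1))\frac p4\log p$. -/

import Mathlib

open MeasureTheory Filter Asymptotics Topology
open scoped Matrix ENNReal

noncomputable section

/-- The rotation group `SO(p)`: real `p × p` matrices with `AᵀA = 1` and `det A = 1`. -/
abbrev SO (p : ℕ) : Type := Matrix.specialOrthogonalGroup (Fin p) ℝ

/-- `SO(p)` carries its Borel σ-algebra (for the topology inherited from `p × p` matrices). -/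
instance SO.instMeasurableSpace (p : ℕ) : MeasurableSpace (SO p) := borel _

instance SO.instBorelSpace (p : ℕ) : BorelSpace (SO p) := ⟨rfl⟩

instance SO.instIsTopologicalGroup (p : ℕ) : IsTopologicalGroup (SO p) where
  continuous_inv := by
    refine continuous_induced_rng.mpr ?_
    exact continuous_subtype_val.star

theorem SO.isCompact_carrier (p : ℕ) :
    IsCompact (Matrix.specialOrthogonalGroup (Fin p) ℝ : Set (Matrix (Fin p) (Fin p) ℝ)) := by
  have hbox : IsCompact (Set.univ.pi fun _ : Fin p => Set.univ.pi fun _ : Fin p =>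
      Set.Icc (-1 : ℝ) 1) :=
    isCompact_univ_pi fun _ => isCompact_univ_pi fun _ => isCompact_Icc
  refine hbox.of_isClosed_subset ?_ ?_
  · have h : (Matrix.specialOrthogonalGroup (Fin p) ℝ : Set (Matrix (Fin p) (Fin p) ℝ)) =
        (unitary (Matrix (Fin p) (Fin p) ℝ) : Set (Matrix (Fin p) (Fin p) ℝ)) ∩
          {A | A.det = 1} := by
      ext A
      exact Matrix.mem_specialOrthogonalGroup_iff
    rw [h]
    exact (isClosed_unitary (R := Matrix (Fin p) (Fin p) ℝ)).inter
      (isClosed_eq (Continuous.matrix_det continuous_id) continuous_const)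
  · intro A hA i _ j _
    have hA' := (Matrix.mem_specialOrthogonalGroup_iff.mp hA).1
    have := entry_norm_bound_of_unitary (𝕜 := ℝ) hA' i j
    exact abs_le.mp (by simpa [Real.norm_eq_abs] using this)

instance SO.instCompactSpace (p : ℕ) : CompactSpace (SO p) :=
  isCompact_iff_compactSpace.mp (SO.isCompact_carrier p)

/-- Haar probability measure on `SO(p)` (total mass one). -/
def haarSO (p : ℕ) : Measure (SO p) := Measure.haarMeasure ⊤

/-- The number `‖v‖₀` of non-zero entries of a vector. -/
def l0norm {p : ℕ} (v : Fin p → ℝ) : ℕ := (Finset.univ.filter fun j => v j ≠ 0).card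

/-- The second moment matrix `E[W W']` of a random vector. -/
def secondMoment {Ω : Type*} [MeasurableSpace Ω] {p : ℕ} (P : Measure Ω)
    (W : Ω → Fin p → ℝ) : Matrix (Fin p) (Fin p) ℝ :=
  Matrix.of fun i j => ∫ ω, W ω i * W ω j ∂P

/-- The mean squared error `E[(W'γ - (RW)'v)²]` when the control function `W'γ` is approximated
by the linear combination with coefficients `v` of the rotated regressors `RW`. The expectation
is over `W`, with `R` held fixed. -/
def meanSqError {Ω : Type*} [MeasurableSpace Ω] {p : ℕ} (P : Measure Ω)
    (W : Ω → Fin p → ℝ) (γ : Fin p → ℝ) (R : SO p) (v : Fin p → ℝ) : ℝ :=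
  ∫ ω, (W ω ⬝ᵥ γ - ((R : Matrix (Fin p) (Fin p) ℝ) *ᵥ W ω) ⬝ᵥ v) ^ 2 ∂P

/-- The best mean squared approximation error in the rotated model over coefficient vectors
with at most `s` non-zero entries. -/
def approxError {Ω : Type*} [MeasurableSpace Ω] {p : ℕ} (P : Measure Ω)
    (W : Ω → Fin p → ℝ) (γ : Fin p → ℝ) (R : SO p) (s : ℕ) : ℝ :=
  ⨅ v : {v : Fin p → ℝ // l0norm v ≤ s}, meanSqError P W γ R v

/-- The probability, for a Haar-distributed rotation `R`, that the model with regressor `RW`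
has an approximation by `s` regressors with mean squared error at most `C s / p`. -/
def sparseProb {Ω : Type*} [MeasurableSpace Ω] {p : ℕ} (P : Measure Ω)
    (W : Ω → Fin p → ℝ) (γ : Fin p → ℝ) (s : ℕ) (C : ℝ) : ℝ≥0∞ :=
  haarSO p {R | approxError P W γ R s ≤ C * s / p}

/-- A sequence of sparsity indices with `s = o(√p / log p)`. -/
def IsSparsityIndex (s : ℕ → ℕ) : Prop :=
  (fun p => (s p : ℝ)) =o[atTop] fun p : ℕ => √(p : ℝ) / Real.log p

end

/-! The mean squared error is the quadratic form of $E[WW']$ at $\gamma-R'v$, so by the eigenvalue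
bounds it is comparable to $\|R\gamma-v\|^2$. An $s$-sparse $v$ with small error therefore exists
essentially when $R\gamma$ lies in the cone of vectors within relative distance
$\delta\asymp\sqrt{s/p}$ of a coordinate subspace of dimension $s$. As $R\gamma$ is uniform on a
sphere, the probability of a cone is its share of the unit ball (`haarSO_mulVec_mem_mul_volume`),
and squeezing $p-s$ coordinates by $\delta$ makes this share about $\delta^{p-s}$, up to factors
exponential in $p$.

Upper bound (`sparseProb_le`): a union over at most $p^s$ supports. For $s\le\sqrt p$ one has
$\delta\lesssim p^{-1/4}$, hence the main term $-\frac p4\log p$; the terms $s\log p$ and $O(p)$ are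
of lower order. Lower bound (`le_sparseProb`): a single coordinate axis suffices. With
$s\approx\sqrt p/\log^2p$, $\delta$ is $p^{-1/4}$ up to a logarithmic factor, which costs only
$O(p\log\log p)$. -/

/-! ### Reflections and transitivity on spheres -/

/-- The Householder reflection in the hyperplane orthogonal to `u`. -/
noncomputable def householder {p : ℕ} (u : Fin p → ℝ) : Matrix (Fin p) (Fin p) ℝ :=
  1 - Matrix.vecMulVec ((2 / (u ⬝ᵥ u)) • u) u

theorem householder_mulVec {p : ℕ} (u x : Fin p → ℝ) :
    householder u *ᵥ x = x - (2 * (u ⬝ᵥ x) / (u ⬝ᵥ u)) • u := by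
  rw [householder, Matrix.sub_mulVec, Matrix.one_mulVec, Matrix.vecMulVec_mulVec]
  ext i
  simp
  ring

theorem householder_transpose {p : ℕ} (u : Fin p → ℝ) : (householder u)ᵀ = householder u := by
  ext i j
  simp only [householder, Matrix.transpose_apply, Matrix.sub_apply, Matrix.vecMulVec_apply,
    Pi.smul_apply, smul_eq_mul, Matrix.one_apply, eq_comm (a := j)]
  ring

theorem householder_mul_self {p : ℕ} {u : Fin p → ℝ} (hu : u ⬝ᵥ u ≠ 0) :
    householder u * householder u = 1 := by
  apply Matrix.ext_of_mulVec_single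
  intro i
  rw [← Matrix.mulVec_mulVec, Matrix.one_mulVec, householder_mulVec, householder_mulVec]
  rw [dotProduct_sub, dotProduct_smul, smul_eq_mul]
  ext j
  simp only [Pi.sub_apply, Pi.smul_apply, smul_eq_mul]
  field_simp
  ring

theorem householder_det {p : ℕ} {u : Fin p → ℝ} (hu : u ⬝ᵥ u ≠ 0) : (householder u).det = -1 := by
  rw [householder, Matrix.vecMulVec_eq Unit, Matrix.det_one_sub_mul_comm, Matrix.det_unique]
  simp only [Matrix.sub_apply, Matrix.one_apply_eq, Matrix.mul_apply, Matrix.replicateRow_apply,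
    Matrix.replicateCol_apply, Pi.smul_apply, smul_eq_mul]
  have : ∑ j, u j * (2 / (u ⬝ᵥ u) * u j) = 2 / (u ⬝ᵥ u) * (u ⬝ᵥ u) := by
    rw [dotProduct, Finset.mul_sum]
    exact Finset.sum_congr rfl fun j _ => by ring
  rw [this, div_mul_cancel₀ _ hu]
  norm_num

/-- `SO(p)` acts transitively on spheres when `p ≥ 2`. -/
theorem exists_SO_mulVec_eq {p : ℕ} (hp : 2 ≤ p) {x y : Fin p → ℝ} (hxy : x ⬝ᵥ x = y ⬝ᵥ y) :
    ∃ Q : SO p, (Q : Matrix (Fin p) (Fin p) ℝ) *ᵥ x = y := by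
  by_cases h : x = y
  · exact ⟨1, by simp [h]⟩
  have : Nontrivial (Fin p) := Fin.nontrivial_iff_two_le.mpr hp
  -- Reflecting in $x-y$ sends $x$ to $y$ but has determinant $-1$. A second reflection, in some
  -- $w\perp y$, fixes $y$ and restores determinant $1$; such a $w\ne0$ needs $p\ge2$.
  obtain ⟨w, hw0, hwy⟩ := exists_ne_zero_dotProduct_eq_zero y
  have hu : (x - y) ⬝ᵥ (x - y) ≠ 0 := by
    rw [Ne, dotProduct_self_eq_zero]
    exact sub_ne_zero.mpr h
  have hw : w ⬝ᵥ w ≠ 0 := by rwa [Ne, dotProduct_self_eq_zero]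
  refine ⟨⟨householder w * householder (x - y), ?_⟩, ?_⟩
  · rw [Matrix.mem_specialOrthogonalGroup_iff, Matrix.mem_orthogonalGroup_iff]
    constructor
    · rw [Matrix.transpose_mul, householder_transpose, householder_transpose, Matrix.mul_assoc,
        ← Matrix.mul_assoc (householder (x - y)), householder_mul_self hu, Matrix.one_mul,
        householder_mul_self hw]
    · rw [Matrix.det_mul, householder_det hu, householder_det hw]
      norm_num
  · change (householder w * householder (x - y)) *ᵥ x = y
    have hux : 2 * ((x - y) ⬝ᵥ x) = (x - y) ⬝ᵥ (x - y) := by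
      simp only [sub_dotProduct, dotProduct_sub]
      rw [← hxy, dotProduct_comm x y]
      ring
    rw [← Matrix.mulVec_mulVec, householder_mulVec (x - y), hux, div_self hu, one_smul,
      sub_sub_cancel, householder_mulVec, hwy]
    simp

/-! ### Invariance of the Haar probability measure -/

theorem SO.transpose_mul_self {p : ℕ} (R : SO p) :
    (R : Matrix (Fin p) (Fin p) ℝ)ᵀ * (R : Matrix (Fin p) (Fin p) ℝ) = 1 := by
  exact (Matrix.mem_orthogonalGroup_iff' (Fin p) ℝ).mp
    (Matrix.mem_specialOrthogonalGroup_iff.mp R.2).1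

theorem SO.det_eq_one {p : ℕ} (R : SO p) : (R : Matrix (Fin p) (Fin p) ℝ).det = 1 :=
  (Matrix.mem_specialOrthogonalGroup_iff.mp R.2).2

theorem SO.mulVec_dotProduct_mulVec {p : ℕ} (R : SO p) (x y : Fin p → ℝ) :
    ((R : Matrix (Fin p) (Fin p) ℝ) *ᵥ x) ⬝ᵥ ((R : Matrix (Fin p) (Fin p) ℝ) *ᵥ y) = x ⬝ᵥ y := by
  rw [Matrix.dotProduct_mulVec, Matrix.vecMul_mulVec, SO.transpose_mul_self, Matrix.vecMul_one]

instance haarSO.instIsHaarMeasure (p : ℕ) : (haarSO p).IsHaarMeasure := by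
  unfold haarSO; infer_instance

instance haarSO.instIsProbabilityMeasure (p : ℕ) : IsProbabilityMeasure (haarSO p) :=
  ⟨by
    have := Measure.haarMeasure_self (K₀ := (⊤ : TopologicalSpace.PositiveCompacts (SO p)))
    simpa [haarSO] using this⟩

/-- A right translate of the measure is again a Haar probability measure, so uniqueness applies.
Right invariance is what allows the base point $x$ of $Rx$ to be moved along its sphere. -/
instance haarSO.instIsMulRightInvariant (p : ℕ) : (haarSO p).IsMulRightInvariant :=
  ⟨fun g => by
    have : IsProbabilityMeasure (Measure.map (· * g) (haarSO p)) :=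
      Measure.isProbabilityMeasure_map (measurable_mul_const g).aemeasurable
    exact Measure.isHaarMeasure_eq_of_isProbabilityMeasure _ _⟩

/-! ### Haar probability of cones as a share of volume -/

/-- The closed Euclidean unit ball of `ℝ^p`. -/
def unitBall (p : ℕ) : Set (Fin p → ℝ) := {z | z ⬝ᵥ z ≤ 1}

theorem isClosed_unitBall (p : ℕ) : IsClosed (unitBall p) :=
  isClosed_le (continuous_id.dotProduct continuous_id) continuous_const

theorem sq_le_dotProduct_self {p : ℕ} (z : Fin p → ℝ) (i : Fin p) : z i ^ 2 ≤ z ⬝ᵥ z := by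
  rw [sq]
  exact Finset.single_le_sum (f := fun i => z i * z i) (fun j _ => mul_self_nonneg _)
    (Finset.mem_univ i)

theorem volume_unitBall_ne_top (p : ℕ) : volume (unitBall p) ≠ ⊤ := by
  have hsub : unitBall p ⊆ Set.univ.pi fun _ => Set.Icc (-1 : ℝ) 1 := fun z hz i _ => by
    have := (sq_le_dotProduct_self z i).trans hz
    exact abs_le.mp ((sq_le_one_iff_abs_le_one _).mp this)
  exact ((isCompact_univ_pi fun _ => isCompact_Icc).measure_lt_top.trans_le'
    (measure_mono hsub)).ne

theorem volume_unitBall_ne_zero (p : ℕ) : volume (unitBall p) ≠ 0 := by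
  have hopen : IsOpen {z : Fin p → ℝ | z ⬝ᵥ z < 1} :=
    isOpen_lt (continuous_id.dotProduct continuous_id) continuous_const
  refine fun h => hopen.measure_ne_zero volume ⟨0, by simp⟩ (measure_mono_null ?_ h)
  exact fun z (hz : z ⬝ᵥ z < 1) => hz.le

/-- For a closed cone `A`, the Haar probability of `R x ∈ A` is the proportion of the unit ball
that is filled by `A`. -/
theorem haarSO_mulVec_mem_mul_volume {p : ℕ} (hp : 2 ≤ p) {A : Set (Fin p → ℝ)} (hA : IsClosed A)
    (hcone : ∀ c : ℝ, 0 < c → ∀ z ∈ A, c • z ∈ A) {x : Fin p → ℝ} (hx : x ≠ 0) :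
    haarSO p {R | (R : Matrix (Fin p) (Fin p) ℝ) *ᵥ x ∈ A} * volume (unitBall p) =
      volume (A ∩ unitBall p) := by
  have : SecondCountableTopology (Matrix (Fin p) (Fin p) ℝ) :=
    inferInstanceAs (SecondCountableTopology (Fin p → Fin p → ℝ))
  have hact : Continuous fun q : SO p × (Fin p → ℝ) =>
      (q.1 : Matrix (Fin p) (Fin p) ℝ) *ᵥ q.2 :=
    (continuous_subtype_val.comp continuous_fst).matrix_mulVec continuous_snd
  -- Fubini on $E=\{(R,z): Rz\in A,\ \|z\|\le1\}$: each slice at fixed $R$ is a volume-preserving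
  -- preimage of $A\cap B$, and each slice at fixed $z\in B\setminus\{0\}$ has the probability
  -- sought.
  let E : Set (SO p × (Fin p → ℝ)) :=
    {q | (q.1 : Matrix (Fin p) (Fin p) ℝ) *ᵥ q.2 ∈ A ∧ q.2 ∈ unitBall p}
  have hE : MeasurableSet E :=
    ((hA.preimage hact).inter ((isClosed_unitBall p).preimage continuous_snd)).measurableSet
  have hleft : ((haarSO p).prod volume) E = volume (A ∩ unitBall p) := by
    rw [Measure.prod_apply hE]
    have : ∀ R : SO p, volume (Prod.mk R ⁻¹' E) = volume (A ∩ unitBall p) := fun R => by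
      have h : Prod.mk R ⁻¹' E =
          (Matrix.toLin' (R : Matrix (Fin p) (Fin p) ℝ)) ⁻¹' (A ∩ unitBall p) := by
        ext z
        simp [E, unitBall, SO.mulVec_dotProduct_mulVec]
      rw [h, Measure.addHaar_preimage_linearMap _ (by simp [SO.det_eq_one])]
      simp [SO.det_eq_one]
    simp [this]
  have hright : ((haarSO p).prod volume) E =
      haarSO p {R | (R : Matrix (Fin p) (Fin p) ℝ) *ᵥ x ∈ A} * volume (unitBall p) := by
    rw [Measure.prod_apply_symm hE, ← setLIntegral_const,
      ← lintegral_indicator (isClosed_unitBall p).measurableSet]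
    have hnull : ∀ᵐ z : Fin p → ℝ, z ≠ 0 := by
      have : Nonempty (Fin p) := ⟨⟨0, by omega⟩⟩
      rw [ae_iff]
      simp
    refine lintegral_congr_ae (hnull.mono fun z hz => ?_)
    by_cases hzB : z ∈ unitBall p
    · rw [Set.indicator_of_mem hzB]
      have hzz : 0 < z ⬝ᵥ z := by simpa using Matrix.dotProduct_star_self_pos_iff.mpr hz
      have hxx : 0 < x ⬝ᵥ x := by simpa using Matrix.dotProduct_star_self_pos_iff.mpr hx
      -- Write $z=cQx$ with $c=\|z\|/\|x\|$. The cone property removes $c$ and right invariance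
      -- removes $Q$.
      have hc : 0 < √(z ⬝ᵥ z / x ⬝ᵥ x) := by positivity
      obtain ⟨Q, hQ⟩ := exists_SO_mulVec_eq hp (x := √(z ⬝ᵥ z / x ⬝ᵥ x) • x) (y := z) (by
        rw [smul_dotProduct, dotProduct_smul, smul_eq_mul, smul_eq_mul, ← mul_assoc,
          Real.mul_self_sqrt (by positivity), div_mul_cancel₀ _ hxx.ne'])
      generalize √(z ⬝ᵥ z / x ⬝ᵥ x) = c at hc hQ
      have h : (fun R => (R, z)) ⁻¹' E =
          (fun R => R * Q) ⁻¹' {R : SO p | (R : Matrix (Fin p) (Fin p) ℝ) *ᵥ x ∈ A} := by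
        ext R
        have : (R : Matrix (Fin p) (Fin p) ℝ) *ᵥ z =
            c • (((R * Q : SO p) : Matrix (Fin p) (Fin p) ℝ) *ᵥ x) := by
          rw [← hQ, Matrix.mulVec_smul, Matrix.mulVec_smul, Matrix.mulVec_mulVec]
          rfl
        simp only [E, Set.mem_preimage, Set.mem_ofPred_eq, hzB, and_true, this]
        refine ⟨fun h => ?_, hcone c hc _⟩
        simpa [smul_smul, inv_mul_cancel₀ hc.ne'] using hcone c⁻¹ (inv_pos.mpr hc) _ h
      exact (congrArg (haarSO p) h).trans (measure_preimage_mul_right _ _ _)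
    · rw [Set.indicator_of_notMem hzB]
      have h : (fun R => (R, z)) ⁻¹' E = ∅ := by
        ext R
        simp [E, hzB]
      exact (congrArg (haarSO p) h).trans measure_empty
  rw [← hright, hleft]

/-! ### Volume of the cones around coordinate subspaces -/

/-- The cone of vectors whose coordinates outside `S` have Euclidean norm at most `δ` times the
norm of the vector. -/
def sparseCone {p : ℕ} (S : Finset (Fin p)) (δ : ℝ) : Set (Fin p → ℝ) :=
  {z | ∑ i ∈ Sᶜ, z i ^ 2 ≤ δ ^ 2 * (z ⬝ᵥ z)}

theorem isClosed_sparseCone {p : ℕ} (S : Finset (Fin p)) (δ : ℝ) : IsClosed (sparseCone S δ) :=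
  isClosed_le (by fun_prop) (continuous_const.mul (continuous_id.dotProduct continuous_id))

theorem smul_mem_sparseCone {p : ℕ} {S : Finset (Fin p)} {δ : ℝ} {z : Fin p → ℝ}
    (hz : z ∈ sparseCone S δ) (c : ℝ) : c • z ∈ sparseCone S δ := by
  change ∑ i ∈ Sᶜ, (c * z i) ^ 2 ≤ δ ^ 2 * ((c • z) ⬝ᵥ (c • z))
  have h : ∑ i ∈ Sᶜ, z i ^ 2 ≤ δ ^ 2 * (z ⬝ᵥ z) := hz
  simp only [mul_pow, ← Finset.mul_sum, smul_dotProduct, dotProduct_smul, smul_eq_mul]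
  nlinarith [mul_le_mul_of_nonneg_left h (sq_nonneg c)]

theorem dotProduct_self_eq_add {p : ℕ} (S : Finset (Fin p)) (z : Fin p → ℝ) :
    z ⬝ᵥ z = ∑ i ∈ S, z i ^ 2 + ∑ i ∈ Sᶜ, z i ^ 2 := by
  rw [Finset.sum_add_sum_compl, dotProduct]
  exact Finset.sum_congr rfl fun i _ => (sq _).symm

-- Dividing the coordinates outside $S$ by $\delta$ leaves two blocks of norm at most $1$ each,
-- hence a vector in the ball of radius $2$. The diagonal map undoing this has determinant
-- $\delta^{p-|S|}$.
open scoped Pointwise in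
theorem volume_sparseCone_inter_le {p : ℕ} (S : Finset (Fin p)) {δ : ℝ} (hδ : 0 < δ) :
    volume (sparseCone S δ ∩ unitBall p) ≤
      ENNReal.ofReal (δ ^ (p - S.card) * 2 ^ p) * volume (unitBall p) := by
  let d : Fin p → ℝ := fun i => if i ∈ S then 1 else δ
  have hd : ∀ i, d i ≠ 0 := fun i => by
    by_cases h : i ∈ S <;> simp [d, h, hδ.ne']
  have hdet : (Matrix.diagonal d).det = δ ^ (p - S.card) := by
    rw [Matrix.det_diagonal, ← Finset.prod_mul_prod_compl S]
    rw [Finset.prod_congr (s₁ := S) rfl (g := fun _ => (1 : ℝ)) fun i hi => by simp [d, hi],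
      Finset.prod_congr (s₁ := Sᶜ) rfl (g := fun _ => δ) fun i hi => by
        simp [d, Finset.mem_compl.mp hi]]
    simp [Finset.card_compl]
  have hsub : sparseCone S δ ∩ unitBall p ⊆
      Matrix.toLin' (Matrix.diagonal d) '' ((2 : ℝ) • unitBall p) := by
    rintro z ⟨hz, hzB⟩
    have hz : ∑ i ∈ Sᶜ, z i ^ 2 ≤ δ ^ 2 * (z ⬝ᵥ z) := hz
    have hzB : z ⬝ᵥ z ≤ 1 := hzB
    refine ⟨fun i => z i / d i, ?_, ?_⟩
    · refine ⟨fun i => z i / d i / 2, ?_, ?_⟩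
      · change (fun i => z i / d i / 2) ⬝ᵥ (fun i => z i / d i / 2) ≤ 1
        rw [dotProduct_self_eq_add S]
        have h1 : ∑ i ∈ S, (z i / d i / 2) ^ 2 = (∑ i ∈ S, z i ^ 2) / 4 := by
          rw [Finset.sum_div]
          exact Finset.sum_congr rfl fun i hi => by simp [d, hi]; ring
        have h2 : ∑ i ∈ Sᶜ, (z i / d i / 2) ^ 2 = (∑ i ∈ Sᶜ, z i ^ 2) / (δ ^ 2 * 4) := by
          rw [Finset.sum_div]
          exact Finset.sum_congr rfl fun i hi => by
            simp [d, Finset.mem_compl.mp hi]; field_simp; ring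
        have h3 : (∑ i ∈ Sᶜ, z i ^ 2) / (δ ^ 2 * 4) ≤ 1 / 4 := by
          rw [div_le_div_iff₀ (by positivity) (by norm_num)]
          nlinarith [sq_nonneg δ]
        have h4 := dotProduct_self_eq_add S z
        have h5 : 0 ≤ ∑ i ∈ Sᶜ, z i ^ 2 := Finset.sum_nonneg fun i _ => sq_nonneg _
        rw [h1, h2]
        linarith
      · ext i
        simp
        ring
    · ext i
      simp [Matrix.mulVec_diagonal, mul_div_cancel₀ _ (hd i)]
  refine (measure_mono hsub).trans ?_
  rw [Measure.addHaar_image_linearMap, Measure.addHaar_smul, LinearMap.det_toLin', hdet, ← mul_assoc,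
    ← ENNReal.ofReal_mul (abs_nonneg _), abs_of_pos (by positivity), abs_of_pos (by positivity)]
  simp

-- The ball of radius $\delta/8$ about $\frac34e_i$ fits inside: its points have $i$-th coordinate
-- in $[\frac12,\frac78]$ and a remainder of norm at most $\delta/8$.
open scoped Pointwise in
theorem le_volume_sparseCone_inter {p : ℕ} (i : Fin p) {δ : ℝ} (hδ : 0 < δ) (hδ1 : δ ≤ 1) :
    ENNReal.ofReal ((δ / 8) ^ p) * volume (unitBall p) ≤
      volume (sparseCone {i} δ ∩ unitBall p) := by
  have hsub : (fun y => Pi.single i (3 / 4) + y) '' ((δ / 8) • unitBall p) ⊆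
      sparseCone {i} δ ∩ unitBall p := by
    rintro _ ⟨_, ⟨y, hy, rfl⟩, rfl⟩
    have hy : y ⬝ᵥ y ≤ 1 := hy
    have hyS := dotProduct_self_eq_add {i} y
    rw [Finset.sum_singleton] at hyS
    have h0 : 0 ≤ ∑ j ∈ ({i} : Finset (Fin p))ᶜ, y j ^ 2 :=
      Finset.sum_nonneg fun j _ => sq_nonneg _
    have hyi : |y i| ≤ 1 := (sq_le_one_iff_abs_le_one _).mp (by linarith)
    obtain ⟨hl, hu⟩ := abs_le.mp hyi
    have hz := dotProduct_self_eq_add {i} (Pi.single i (3 / 4) + (δ / 8) • y)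
    have hc : ∑ j ∈ ({i} : Finset (Fin p))ᶜ, (Pi.single i (3 / 4) + (δ / 8) • y : Fin p → ℝ) j ^ 2 =
        (δ / 8) ^ 2 * ∑ j ∈ ({i} : Finset (Fin p))ᶜ, y j ^ 2 := by
      rw [Finset.mul_sum]
      refine Finset.sum_congr rfl fun j hj => ?_
      have : j ≠ i := by simpa using hj
      simp [this]
      ring
    have hi : (Pi.single i (3 / 4) + (δ / 8) • y : Fin p → ℝ) i = 3 / 4 + δ / 8 * y i := by simp
    rw [Finset.sum_singleton, hc, hi] at hz
    have hδ2 : δ ^ 2 ≤ 1 := by nlinarith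
    have hlo : (1 / 2 : ℝ) ≤ 3 / 4 + δ / 8 * y i := by nlinarith
    have hhi : 3 / 4 + δ / 8 * y i ≤ 7 / 8 := by nlinarith
    constructor
    · change ∑ j ∈ ({i} : Finset (Fin p))ᶜ,
        (Pi.single i (3 / 4) + (δ / 8) • y : Fin p → ℝ) j ^ 2 ≤ δ ^ 2 * _
      rw [hc]
      dsimp only
      rw [hz]
      have : (δ / 8) ^ 2 * ∑ j ∈ ({i} : Finset (Fin p))ᶜ, y j ^ 2 ≤ (δ / 8) ^ 2 * 1 :=
        mul_le_mul_of_nonneg_left (by nlinarith) (sq_nonneg _)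
      have h4 : (1 / 4 : ℝ) ≤ (3 / 4 + δ / 8 * y i) ^ 2 := by nlinarith
      have h5 : 0 ≤ (δ / 8) ^ 2 * ∑ j ∈ ({i} : Finset (Fin p))ᶜ, y j ^ 2 := by positivity
      nlinarith [mul_le_mul_of_nonneg_left (h4.trans (le_add_of_nonneg_right h5)) (sq_nonneg δ)]
    · change _ ≤ (1 : ℝ)
      dsimp only
      rw [hz]
      have : (δ / 8) ^ 2 * ∑ j ∈ ({i} : Finset (Fin p))ᶜ, y j ^ 2 ≤ 1 / 64 * 1 :=
        mul_le_mul (by nlinarith) (by nlinarith) h0 (by norm_num)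
      nlinarith
  refine le_trans (le_of_eq ?_) (measure_mono hsub)
  rw [Set.image_add_left, measure_preimage_add, Measure.addHaar_smul,
    abs_of_pos (by positivity)]
  simp

theorem haarSO_mulVec_mem_sparseCone_le {p : ℕ} (hp : 2 ≤ p) {x : Fin p → ℝ} (hx : x ≠ 0)
    (S : Finset (Fin p)) {δ : ℝ} (hδ : 0 < δ) :
    haarSO p {R | (R : Matrix (Fin p) (Fin p) ℝ) *ᵥ x ∈ sparseCone S δ} ≤
      ENNReal.ofReal (δ ^ (p - S.card) * 2 ^ p) := by
  rw [← ENNReal.mul_le_mul_iff_left (volume_unitBall_ne_zero p) (volume_unitBall_ne_top p),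
    haarSO_mulVec_mem_mul_volume hp (isClosed_sparseCone S δ)
      (fun c _ z hz => smul_mem_sparseCone hz c) hx]
  exact volume_sparseCone_inter_le S hδ

theorem le_haarSO_mulVec_mem_sparseCone {p : ℕ} (hp : 2 ≤ p) {x : Fin p → ℝ} (hx : x ≠ 0)
    (i : Fin p) {δ : ℝ} (hδ : 0 < δ) (hδ1 : δ ≤ 1) :
    ENNReal.ofReal ((δ / 8) ^ p) ≤
      haarSO p {R | (R : Matrix (Fin p) (Fin p) ℝ) *ᵥ x ∈ sparseCone {i} δ} := by
  rw [← ENNReal.mul_le_mul_iff_left (volume_unitBall_ne_zero p) (volume_unitBall_ne_top p),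
    haarSO_mulVec_mem_mul_volume hp (isClosed_sparseCone {i} δ)
      (fun c _ z hz => smul_mem_sparseCone hz c) hx]
  exact le_volume_sparseCone_inter i hδ hδ1

/-! ### Quadratic forms and eigenvalue bounds -/

theorem Matrix.IsHermitian.le_dotProduct_mulVec {p : ℕ} {M : Matrix (Fin p) (Fin p) ℝ}
    (hM : M.IsHermitian) {a : ℝ}
    (ha : ∀ t : ℝ, Module.End.HasEigenvalue (Matrix.toLin' M) t → a ≤ t) (u : Fin p → ℝ) :
    a * (u ⬝ᵥ u) ≤ u ⬝ᵥ (M *ᵥ u) := by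
  have hN : (M - a • (1 : Matrix (Fin p) (Fin p) ℝ)).IsHermitian :=
    hM.sub (Matrix.isHermitian_one.smul (IsSelfAdjoint.all a))
  have hpos : (M - a • (1 : Matrix (Fin p) (Fin p) ℝ)).PosSemidef := by
    rw [hN.posSemidef_iff_eigenvalues_nonneg]
    intro i
    have hv := hN.mulVec_eigenvectorBasis i
    rw [Matrix.sub_mulVec, Matrix.smul_mulVec, Matrix.one_mulVec, sub_eq_iff_eq_add,
      ← add_smul] at hv
    have := ha (hN.eigenvalues i + a) (Module.End.hasEigenvalue_of_hasEigenvector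
      (x := hN.eigenvectorBasis i) ⟨Module.End.mem_eigenspace_iff.mpr hv, fun h =>
        hN.eigenvectorBasis.toBasis.ne_zero i (by ext j; simpa using congrFun h j)⟩)
    simpa using this
  have := hpos.dotProduct_mulVec_nonneg u
  simp only [star_trivial, Matrix.sub_mulVec, Matrix.smul_mulVec, Matrix.one_mulVec,
    dotProduct_sub, dotProduct_smul, smul_eq_mul] at this
  linarith

theorem Matrix.IsHermitian.dotProduct_mulVec_le {p : ℕ} {M : Matrix (Fin p) (Fin p) ℝ}
    (hM : M.IsHermitian) {b : ℝ}
    (hb : ∀ t : ℝ, Module.End.HasEigenvalue (Matrix.toLin' M) t → t ≤ b) (u : Fin p → ℝ) :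
    u ⬝ᵥ (M *ᵥ u) ≤ b * (u ⬝ᵥ u) := by
  have := hM.neg.le_dotProduct_mulVec (a := -b) (fun t ht => ?_) u
  · rw [Matrix.neg_mulVec, dotProduct_neg] at this
    linarith
  · obtain ⟨v, hv⟩ := ht.exists_hasEigenvector
    have h := hv.apply_eq_smul
    rw [map_neg, LinearMap.neg_apply] at h
    refine neg_le.mp (hb (-t) (Module.End.hasEigenvalue_of_hasEigenvector (x := v)
      ⟨Module.End.mem_eigenspace_iff.mpr ?_, hv.2⟩))
    rw [neg_smul, ← h, neg_neg]

/-! ### From mean squared error to cones -/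

section

variable {Ω : Type*} [MeasurableSpace Ω] {p : ℕ} {P : Measure Ω} {W : Ω → Fin p → ℝ}

theorem isHermitian_secondMoment (P : Measure Ω) (W : Ω → Fin p → ℝ) :
    (secondMoment P W).IsHermitian := by
  ext i j
  simp [secondMoment, mul_comm]

theorem integral_dotProduct_sq (hW : ∀ j, MemLp (fun ω => W ω j) 2 P) (u : Fin p → ℝ) :
    ∫ ω, (W ω ⬝ᵥ u) ^ 2 ∂P = u ⬝ᵥ (secondMoment P W *ᵥ u) := by
  have hint : ∀ i j, Integrable (fun ω => u i * (W ω i * W ω j * u j)) P := fun i j =>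
    (((hW i).integrable_mul (hW j)).mul_const _).const_mul _
  have h : ∀ ω, (W ω ⬝ᵥ u) ^ 2 = ∑ i, ∑ j, u i * (W ω i * W ω j * u j) := fun ω => by
    rw [sq, dotProduct, Finset.sum_mul_sum]
    exact Finset.sum_congr rfl fun i _ => Finset.sum_congr rfl fun j _ => by ring
  simp only [h]
  rw [integral_finsetSum _ fun i _ => integrable_finsetSum _ fun j _ => hint i j]
  refine Finset.sum_congr rfl fun i _ => ?_
  rw [integral_finsetSum _ fun j _ => hint i j, Matrix.mulVec, dotProduct, Finset.mul_sum]
  refine Finset.sum_congr rfl fun j _ => ?_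
  rw [integral_const_mul, integral_mul_const]
  rfl

theorem meanSqError_nonneg (P : Measure Ω) (W : Ω → Fin p → ℝ) (γ : Fin p → ℝ) (R : SO p)
    (v : Fin p → ℝ) : 0 ≤ meanSqError P W γ R v :=
  integral_nonneg fun _ => sq_nonneg _

theorem meanSqError_eq (hW : ∀ j, MemLp (fun ω => W ω j) 2 P) (γ : Fin p → ℝ) (R : SO p)
    (v : Fin p → ℝ) :
    meanSqError P W γ R v = (γ - (R : Matrix (Fin p) (Fin p) ℝ)ᵀ *ᵥ v) ⬝ᵥ
      (secondMoment P W *ᵥ (γ - (R : Matrix (Fin p) (Fin p) ℝ)ᵀ *ᵥ v)) := by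
  rw [← integral_dotProduct_sq hW, meanSqError]
  refine integral_congr_ae (Eventually.of_forall fun ω => ?_)
  dsimp only
  rw [dotProduct_sub, Matrix.dotProduct_mulVec (W ω), Matrix.vecMul_transpose]

theorem dotProduct_self_sub_transpose_mulVec (γ : Fin p → ℝ) (R : SO p) (v : Fin p → ℝ) :
    (γ - (R : Matrix (Fin p) (Fin p) ℝ)ᵀ *ᵥ v) ⬝ᵥ (γ - (R : Matrix (Fin p) (Fin p) ℝ)ᵀ *ᵥ v) =
      ((R : Matrix (Fin p) (Fin p) ℝ) *ᵥ γ - v) ⬝ᵥ ((R : Matrix (Fin p) (Fin p) ℝ) *ᵥ γ - v) := by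
  rw [← SO.mulVec_dotProduct_mulVec R, Matrix.mulVec_sub, Matrix.mulVec_mulVec,
    mul_eq_one_comm.mp R.transpose_mul_self, Matrix.one_mulVec]

theorem approxError_le_meanSqError (P : Measure Ω) (W : Ω → Fin p → ℝ) (γ : Fin p → ℝ) (R : SO p)
    {s : ℕ} {v : Fin p → ℝ} (hv : l0norm v ≤ s) : approxError P W γ R s ≤ meanSqError P W γ R v :=
  ciInf_le (f := fun v : {v : Fin p → ℝ // l0norm v ≤ s} => meanSqError P W γ R v)
    ⟨0, by rintro _ ⟨v, rfl⟩; exact meanSqError_nonneg P W γ R v⟩ ⟨v, hv⟩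

instance nonempty_l0norm_le (s : ℕ) : Nonempty {v : Fin p → ℝ // l0norm v ≤ s} :=
  ⟨⟨0, by simp [l0norm]⟩⟩

theorem exists_meanSqError_lt {γ : Fin p → ℝ} {R : SO p} {s : ℕ} {t : ℝ}
    (h : approxError P W γ R s < t) :
    ∃ v : Fin p → ℝ, l0norm v ≤ s ∧ meanSqError P W γ R v < t := by
  obtain ⟨v, hv⟩ := exists_lt_of_ciInf_lt h
  exact ⟨v, v.2, hv⟩

/-- Lets $s$ and $C$ be replaced by $\max(s,1)$ and $\max(C,1)$, making the threshold $Cs/p$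
positive. -/
theorem sparseProb_mono (P : Measure Ω) (W : Ω → Fin p → ℝ) (γ : Fin p → ℝ) {s s' : ℕ}
    (hs : s ≤ s') {C C' : ℝ} (hC : C ≤ C') (hC' : 0 ≤ C') :
    sparseProb P W γ s C ≤ sparseProb P W γ s' C' := by
  refine measure_mono fun R (hR : approxError P W γ R s ≤ C * s / p) => ?_
  have h1 : approxError P W γ R s' ≤ approxError P W γ R s :=
    le_ciInf fun v => approxError_le_meanSqError P W γ R (v.2.trans hs)
  have h2 : C * s / p ≤ C' * s' / p := by gcongr
  exact (h1.trans hR).trans h2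

theorem sparseProb_le (hW : ∀ j, MemLp (fun ω => W ω j) 2 P) {γ : Fin p → ℝ} (hγ : γ ≠ 0)
    (hp : 2 ≤ p) {a : ℝ} (ha0 : 0 < a)
    (ha : ∀ t : ℝ, Module.End.HasEigenvalue (Matrix.toLin' (secondMoment P W)) t → a ≤ t)
    {s : ℕ} (hs : 1 ≤ s) (hsp : s ≤ p) {C δ : ℝ} (hC : 0 < C) (hδ : 0 < δ)
    (hCδ : 2 * (C * s / p) ≤ a * (δ ^ 2 * (γ ⬝ᵥ γ))) :
    sparseProb P W γ s C ≤ ENNReal.ofReal ((p : ℝ) ^ s * (δ ^ (p - s) * 2 ^ p)) := by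
  have hsub : {R : SO p | approxError P W γ R s ≤ C * s / p} ⊆
      ⋃ S ∈ Finset.powersetCard s (Finset.univ : Finset (Fin p)),
        {R : SO p | (R : Matrix (Fin p) (Fin p) ℝ) *ᵥ γ ∈ sparseCone S δ} := by
    intro R (hR : approxError P W γ R s ≤ C * s / p)
    have ht : 0 < C * s / p := by positivity
    -- Attainment of the infimum is avoided: since the threshold is positive, some $v$ has error
    -- below twice it. This is the factor $2$ in `hCδ`.
    obtain ⟨v, hv, hlt⟩ := exists_meanSqError_lt (lt_of_le_of_lt hR (lt_two_mul_self ht))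
    -- Padding the support to exactly $s$ indices leaves only $\binom ps$ cones in the union.
    obtain ⟨S, hvS, hS⟩ := Finset.exists_superset_card_eq hv (by simpa using hsp)
    simp only [Set.mem_iUnion]
    refine ⟨S, by simp [Finset.mem_powersetCard, hS], ?_⟩
    change ∑ i ∈ Sᶜ, ((R : Matrix (Fin p) (Fin p) ℝ) *ᵥ γ) i ^ 2 ≤ δ ^ 2 *
      (((R : Matrix (Fin p) (Fin p) ℝ) *ᵥ γ) ⬝ᵥ ((R : Matrix (Fin p) (Fin p) ℝ) *ᵥ γ))
    rw [SO.mulVec_dotProduct_mulVec]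
    rw [meanSqError_eq hW] at hlt
    have h1 := (isHermitian_secondMoment P W).le_dotProduct_mulVec ha
      (γ - (R : Matrix (Fin p) (Fin p) ℝ)ᵀ *ᵥ v)
    rw [dotProduct_self_sub_transpose_mulVec, dotProduct_self_eq_add S] at h1
    have h2 : ∑ i ∈ Sᶜ, ((R : Matrix (Fin p) (Fin p) ℝ) *ᵥ γ - v) i ^ 2 =
        ∑ i ∈ Sᶜ, ((R : Matrix (Fin p) (Fin p) ℝ) *ᵥ γ) i ^ 2 := by
      refine Finset.sum_congr rfl fun i hi => ?_
      have : v i = 0 := by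
        by_contra hvi
        exact Finset.mem_compl.mp hi (hvS (by simpa using hvi))
      simp [this]
    have h3 : 0 ≤ ∑ i ∈ S, ((R : Matrix (Fin p) (Fin p) ℝ) *ᵥ γ - v) i ^ 2 :=
      Finset.sum_nonneg fun i _ => sq_nonneg _
    rw [h2] at h1
    refine le_of_mul_le_mul_left ?_ ha0
    nlinarith
  refine (measure_mono hsub).trans ((measure_biUnion_finset_le _ _).trans ?_)
  refine (Finset.sum_le_sum (g := fun _ => ENNReal.ofReal (δ ^ (p - s) * 2 ^ p))
    fun S hS => ?_).trans ?_
  · rw [← (Finset.mem_powersetCard.mp hS).2]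
    exact haarSO_mulVec_mem_sparseCone_le hp hγ S hδ
  · rw [Finset.sum_const, Finset.card_powersetCard, Finset.card_univ, Fintype.card_fin,
      nsmul_eq_mul, ENNReal.ofReal_mul (p := (p : ℝ) ^ s) (by positivity),
      ENNReal.ofReal_pow (p := (p : ℝ)) (by positivity), ENNReal.ofReal_natCast]
    gcongr
    exact_mod_cast Nat.choose_le_pow p s

theorem le_sparseProb (hW : ∀ j, MemLp (fun ω => W ω j) 2 P) {γ : Fin p → ℝ} (hγ : γ ≠ 0)
    (hp : 2 ≤ p) {b : ℝ} (hb0 : 0 ≤ b)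
    (hb : ∀ t : ℝ, Module.End.HasEigenvalue (Matrix.toLin' (secondMoment P W)) t → t ≤ b)
    {s : ℕ} (hs : 1 ≤ s) {C δ : ℝ} (hδ : 0 < δ) (hδ1 : δ ≤ 1)
    (hCδ : b * (δ ^ 2 * (γ ⬝ᵥ γ)) ≤ C * s / p) :
    ENNReal.ofReal ((δ / 8) ^ p) ≤ sparseProb P W γ s C := by
  let i : Fin p := ⟨0, by omega⟩
  refine (le_haarSO_mulVec_mem_sparseCone hp hγ i hδ hδ1).trans (measure_mono ?_)
  intro R hR
  have hR : ∑ j ∈ ({i} : Finset (Fin p))ᶜ, ((R : Matrix (Fin p) (Fin p) ℝ) *ᵥ γ) j ^ 2 ≤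
    δ ^ 2 * (((R : Matrix (Fin p) (Fin p) ℝ) *ᵥ γ) ⬝ᵥ ((R : Matrix (Fin p) (Fin p) ℝ) *ᵥ γ)) := hR
  rw [SO.mulVec_dotProduct_mulVec] at hR
  -- The orthogonal projection of $R\gamma$ onto the $i$-th axis: the residual is exactly the part
  -- bounded by the cone condition.
  let v : Fin p → ℝ := Pi.single i (((R : Matrix (Fin p) (Fin p) ℝ) *ᵥ γ) i)
  have hv : l0norm v ≤ s := by
    refine le_trans ?_ hs
    rw [← Finset.card_singleton i]
    refine Finset.card_le_card fun j hj => ?_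
    by_contra hji
    simp only [Finset.mem_filter, Finset.mem_univ, true_and, Finset.mem_singleton] at hj hji
    exact hj (by simp [v, hji])
  refine (approxError_le_meanSqError P W γ R hv).trans ?_
  rw [meanSqError_eq hW]
  refine ((isHermitian_secondMoment P W).dotProduct_mulVec_le hb _).trans (le_trans ?_ hCδ)
  refine mul_le_mul_of_nonneg_left (le_trans (le_of_eq ?_) hR) hb0
  rw [dotProduct_self_sub_transpose_mulVec, dotProduct_self_eq_add {i}]
  have h1 : ∑ j ∈ ({i} : Finset (Fin p)), ((R : Matrix (Fin p) (Fin p) ℝ) *ᵥ γ - v) j ^ 2 = 0 := by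
    simp [v]
  rw [h1, zero_add]
  refine Finset.sum_congr rfl fun j hj => ?_
  have : j ≠ i := by simpa using hj
  simp [v, this]

end

/-! ### Asymptotics of the two bounds -/

theorem tendsto_log_natCast_atTop : Tendsto (fun p : ℕ => Real.log p) atTop atTop :=
  Real.tendsto_log_atTop.comp tendsto_natCast_atTop_atTop

theorem tendsto_sqrt_natCast_atTop : Tendsto (fun p : ℕ => √(p : ℝ)) atTop atTop :=
  Real.tendsto_sqrt_atTop.comp tendsto_natCast_atTop_atTop

theorem norm_toLp_sq {p : ℕ} (γ : Fin p → ℝ) : ‖WithLp.toLp 2 γ‖ ^ 2 = γ ⬝ᵥ γ := by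
  rw [EuclideanSpace.real_norm_sq_eq, dotProduct]
  exact Finset.sum_congr rfl fun i _ => sq _

/-- The logarithm of the union bound over supports is at most `-(1 - ε) p log p / 4`. -/
theorem log_union_bound_le {K ε : ℝ} (hK : 0 < K) (hε : 0 < ε) :
    ∀ᶠ p : ℕ in atTop, ∀ s : ℕ, (s : ℝ) ≤ √(p : ℝ) →
      Real.log ((p : ℝ) ^ s * (√(K / √(p : ℝ)) ^ (p - s) * 2 ^ p)) ≤
        -(1 - ε) * ((p : ℝ) / 4 * Real.log p) := by
  -- The slack is $\frac\varepsilon4p\log p$. The constants $K$ and $2$ use $\frac\varepsilon8$; the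
  -- term $s\log p$ from the supports and $\frac s4\log p$ from the exponent $p-s$ use
  -- $\frac54\cdot\frac\varepsilon{10}=\frac\varepsilon8$.
  filter_upwards [eventually_ge_atTop 1,
    tendsto_log_natCast_atTop.eventually_ge_atTop (8 / ε * (|Real.log K| / 2 + Real.log 2)),
    tendsto_sqrt_natCast_atTop.eventually_ge_atTop (10 / ε)] with p hp hlog hsqrt s hs
  have hp1 : (1 : ℝ) ≤ p := by exact_mod_cast hp
  have hp0 : (0 : ℝ) < p := by linarith
  have hq : 0 < √(p : ℝ) := Real.sqrt_pos.mpr hp0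
  have hqq : √(p : ℝ) * √(p : ℝ) = p := Real.mul_self_sqrt hp0.le
  have hq1 : 1 ≤ √(p : ℝ) := by simpa using hp1
  have hsp : (s : ℝ) ≤ p := by nlinarith
  have hsp' : s ≤ p := by exact_mod_cast hsp
  have hL : 0 ≤ Real.log p := Real.log_nonneg hp1
  rw [Real.log_mul (by positivity) (by positivity), Real.log_mul (by positivity) (by positivity),
    Real.log_pow, Real.log_pow, Real.log_pow, Real.log_sqrt (by positivity),
    Real.log_div hK.ne' hq.ne', Real.log_sqrt hp0.le, Nat.cast_sub hsp']
  set L := Real.log p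
  have h1 : p * (|Real.log K| / 2 + Real.log 2) ≤ p * (ε * L / 8) := by
    refine mul_le_mul_of_nonneg_left ?_ hp0.le
    rw [div_mul_eq_mul_div, div_le_iff₀ hε] at hlog
    linarith
  have h2 : (s : ℝ) * L ≤ ε / 10 * p * L := by
    refine mul_le_mul_of_nonneg_right (hs.trans ?_) hL
    rw [div_le_iff₀ hε] at hsqrt
    nlinarith
  have h3 : ((p : ℝ) - s) * (Real.log K / 2) ≤ p * (|Real.log K| / 2) := by
    have h4 : (0 : ℝ) ≤ s := Nat.cast_nonneg s
    have h5 := le_abs_self (Real.log K)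
    have h6 := abs_nonneg (Real.log K)
    nlinarith
  nlinarith

/-- The logarithm of the lower bound from a single support is at least `-(1 + ε) p log p / 4`. -/
theorem le_log_single_support_bound {K ε : ℝ} (hK : 0 < K) (hε : 0 < ε) :
    ∀ᶠ p : ℕ in atTop, -(1 + ε) * ((p : ℝ) / 4 * Real.log p) ≤
      Real.log ((√(K / (√(p : ℝ) * Real.log p ^ 2)) / 8) ^ p) := by
  have hloglog : ∀ᶠ p : ℕ in atTop, Real.log (Real.log p) ≤ ε / 8 * Real.log p := by
    filter_upwards [tendsto_log_natCast_atTop.eventually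
      (Real.isLittleO_log_id_atTop.bound (show 0 < ε / 8 by positivity)),
      tendsto_log_natCast_atTop.eventually_ge_atTop 0] with p h h0
    rw [id, Real.norm_eq_abs, Real.norm_eq_abs, abs_of_nonneg h0] at h
    exact (le_abs_self _).trans h
  filter_upwards [hloglog, eventually_ge_atTop 1, tendsto_log_natCast_atTop.eventually_ge_atTop 1,
    tendsto_log_natCast_atTop.eventually_ge_atTop (8 / ε * (Real.log 8 - Real.log K / 2))]
    with p hLL hp hL hlog
  have hp0 : (0 : ℝ) < p := by exact_mod_cast hp
  have hq : 0 < √(p : ℝ) := Real.sqrt_pos.mpr hp0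
  have hL0 : 0 < Real.log p := by linarith
  rw [Real.log_pow, Real.log_div (by positivity) (by norm_num), Real.log_sqrt (by positivity),
    Real.log_div hK.ne' (by positivity), Real.log_mul hq.ne' (by positivity), Real.log_pow,
    Real.log_sqrt hp0.le]
  rw [div_mul_eq_mul_div, div_le_iff₀ hε] at hlog
  push_cast
  set L := Real.log p
  -- Of the slack $\frac\varepsilon4\log p$ per factor, half absorbs $\log\log p$ and half the
  -- constants $8$ and $K$.
  have : -(1 + ε) * (L / 4) ≤ (Real.log K - (L / 2 + 2 * Real.log L)) / 2 - Real.log 8 := by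
    linarith
  calc -(1 + ε) * (p / 4 * L) = p * (-(1 + ε) * (L / 4)) := by ring
    _ ≤ _ := mul_le_mul_of_nonneg_left this hp0.le

theorem eventually_log_sq_le_sqrt : ∀ᶠ p : ℕ in atTop, Real.log p ^ 2 ≤ √(p : ℝ) := by
  have h := isLittleO_log_rpow_rpow_atTop 2 (show (0 : ℝ) < 1 / 2 by norm_num)
  filter_upwards [tendsto_natCast_atTop_atTop.eventually (h.bound one_pos),
    tendsto_log_natCast_atTop.eventually_ge_atTop 0] with p hp h0
  rw [one_mul, ← Real.sqrt_eq_rpow, Real.norm_eq_abs, Real.norm_eq_abs,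
    abs_of_nonneg (Real.sqrt_nonneg _)] at hp
  exact_mod_cast (le_abs_self _).trans hp

/-- A sparsity index that stays within a logarithmic factor of the largest allowed order. -/
noncomputable def logSparsity (p : ℕ) : ℕ := ⌊√(p : ℝ) / Real.log p ^ 2⌋₊

theorem isSparsityIndex_logSparsity : IsSparsityIndex logSparsity := by
  refine isLittleO_iff.mpr fun c hc => ?_
  filter_upwards [tendsto_log_natCast_atTop.eventually_ge_atTop (1 / c),
    tendsto_log_natCast_atTop.eventually_ge_atTop 1] with p hL hL1
  have hL0 : 0 < Real.log p := by linarith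
  rw [Real.norm_eq_abs, Real.norm_eq_abs, abs_of_nonneg (Nat.cast_nonneg _),
    abs_of_nonneg (by positivity)]
  refine (Nat.floor_le (by positivity)).trans ?_
  rw [div_le_iff₀ hc] at hL
  rw [sq, ← div_div, div_le_iff₀ hL0]
  have : 0 ≤ √(p : ℝ) / Real.log p := by positivity
  nlinarith

theorem eventually_le_logSparsity :
    ∀ᶠ p : ℕ in atTop, 1 ≤ logSparsity p ∧
      √(p : ℝ) / Real.log p ^ 2 ≤ 2 * (logSparsity p : ℝ) := by
  filter_upwards [eventually_log_sq_le_sqrt,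
    tendsto_log_natCast_atTop.eventually_ge_atTop 1] with p h hL
  have h1 : 1 ≤ √(p : ℝ) / Real.log p ^ 2 := by rwa [one_le_div (by positivity)]
  have h2 : 1 ≤ logSparsity p := (Nat.one_le_floor_iff _).mpr h1
  refine ⟨h2, ?_⟩
  have h3 : √(p : ℝ) / Real.log p ^ 2 < (logSparsity p : ℝ) + 1 := Nat.lt_floor_add_one _
  have h4 : (1 : ℝ) ≤ logSparsity p := by exact_mod_cast h2
  linarith

/-- The upper bound needs no more than this: it gives both $s/p\le p^{-1/2}$ and $s\log p=o(p\log
p)$. -/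
theorem IsSparsityIndex.eventually_le_sqrt {s : ℕ → ℕ} (hs : IsSparsityIndex s) :
    ∀ᶠ p : ℕ in atTop, (s p : ℝ) ≤ √(p : ℝ) := by
  filter_upwards [hs.bound one_pos, tendsto_log_natCast_atTop.eventually_ge_atTop 1] with p h hL
  rw [one_mul, Real.norm_eq_abs, Real.norm_eq_abs, abs_of_nonneg (Nat.cast_nonneg _),
    abs_of_nonneg (by positivity)] at h
  exact h.trans (div_le_self (Real.sqrt_nonneg _) hL)

/-! ### Bounds for the logarithm of the probability -/

theorem eventually_log_sparseProb_le {Ω : ℕ → Type*} [∀ p, MeasurableSpace (Ω p)]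
    {P : ∀ p, Measure (Ω p)} {W : ∀ p, Ω p → Fin p → ℝ} {γ : ∀ p, Fin p → ℝ}
    (hW : ∀ p j, MemLp (fun ω => W p ω j) 2 (P p)) {a g : ℝ} (ha0 : 0 < a) (hg : 0 < g)
    (ha : ∀ᶠ p in atTop, ∀ t : ℝ,
      Module.End.HasEigenvalue (Matrix.toLin' (secondMoment (P p) (W p))) t → a ≤ t)
    (hγ : ∀ᶠ p in atTop, g ≤ γ p ⬝ᵥ γ p) {s : ℕ → ℕ} (hs : IsSparsityIndex s) (C : ℝ) {ε : ℝ}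
    (hε : 0 < ε) :
    ∀ᶠ p : ℕ in atTop, ENNReal.log (sparseProb (P p) (W p) (γ p) (s p) C) ≤
      ((-(1 - ε) * ((p : ℝ) / 4 * Real.log p) : ℝ) : EReal) := by
  have hC : 0 < max C 1 := lt_max_of_lt_right one_pos
  -- $K$ solves $2C/\sqrt p=a\,\delta^2g$ for $\delta^2=K/\sqrt p$, with $\max(C,1)$ in place of
  -- $C$.
  have hK : 0 < 2 * max C 1 / (a * g) := by positivity
  filter_upwards [ha, hγ, hs.eventually_le_sqrt, log_union_bound_le hK hε, eventually_ge_atTop 2]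
    with p hap hγp hsp hbound hp
  have hp1 : (1 : ℝ) ≤ p := by exact_mod_cast (by omega : 1 ≤ p)
  have hp0 : (0 : ℝ) < p := by linarith
  have hq : 0 < √(p : ℝ) := Real.sqrt_pos.mpr hp0
  have hqq : √(p : ℝ) * √(p : ℝ) = p := Real.mul_self_sqrt hp0.le
  have hq1 : 1 ≤ √(p : ℝ) := by simpa using hp1
  have hγ0 : γ p ≠ 0 := fun h => by
    rw [h, zero_dotProduct] at hγp
    linarith
  have hs' : ((max (s p) 1 : ℕ) : ℝ) ≤ √(p : ℝ) := by
    rw [Nat.cast_max]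
    exact max_le hsp (by simpa using hq1)
  have hsle : max (s p) 1 ≤ p := by
    have : ((max (s p) 1 : ℕ) : ℝ) ≤ p := hs'.trans (by nlinarith)
    exact_mod_cast this
  refine (ENNReal.log_monotone ((sparseProb_mono (P p) (W p) (γ p) (le_max_left (s p) 1)
    (le_max_left C 1) hC.le).trans (sparseProb_le (hW p) hγ0 hp ha0 hap (le_max_right _ _) hsle hC
      (δ := √(2 * max C 1 / (a * g) / √(p : ℝ))) (by positivity) ?_))).trans ?_
  · rw [Real.sq_sqrt (by positivity)]
    calc 2 * (max C 1 * (max (s p) 1 : ℕ) / p)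
        ≤ 2 * (max C 1 * √(p : ℝ) / p) := by gcongr
      _ = a * (2 * max C 1 / (a * g) / √(p : ℝ) * g) := by
          field_simp
          rw [sq, hqq]
      _ ≤ _ := by gcongr
  · rw [ENNReal.log_ofReal_of_pos (by positivity)]
    exact EReal.coe_le_coe_iff.mpr (hbound _ hs')

theorem eventually_le_log_sparseProb_logSparsity {Ω : ℕ → Type*} [∀ p, MeasurableSpace (Ω p)]
    {P : ∀ p, Measure (Ω p)} {W : ∀ p, Ω p → Fin p → ℝ} {γ : ∀ p, Fin p → ℝ}
    (hW : ∀ p j, MemLp (fun ω => W p ω j) 2 (P p)) {b g : ℝ} (hb0 : 0 < b) (hg : 0 < g)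
    (hb : ∀ᶠ p in atTop, ∀ t : ℝ,
      Module.End.HasEigenvalue (Matrix.toLin' (secondMoment (P p) (W p))) t → t ≤ b)
    (hγ : ∀ᶠ p in atTop, γ p ≠ 0 ∧ γ p ⬝ᵥ γ p ≤ g) {C : ℝ} (hC : 0 < C) {ε : ℝ}
    (hε : 0 < ε) :
    ∀ᶠ p : ℕ in atTop, ((-(1 + ε) * ((p : ℝ) / 4 * Real.log p) : ℝ) : EReal) ≤
      ENNReal.log (sparseProb (P p) (W p) (γ p) (logSparsity p) C) := by
  -- $K$ solves $b\,\delta^2g=\frac C2\cdot\frac1{\sqrt p\,\log^2p}$ for $\delta^2=K/(\sqrt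
  -- p\,\log^2p)$; the $2$ pays for the floor in `logSparsity`.
  have hK : 0 < C / (2 * b * g) := by positivity
  filter_upwards [hb, hγ, eventually_le_logSparsity, le_log_single_support_bound hK hε,
    eventually_ge_atTop 2, tendsto_log_natCast_atTop.eventually_ge_atTop 1,
    tendsto_sqrt_natCast_atTop.eventually_ge_atTop (C / (2 * b * g))]
    with p hbp hγp hsp hbound hp hL hKp
  have hp0 : (0 : ℝ) < p := by exact_mod_cast (by omega : 0 < p)
  have hq : 0 < √(p : ℝ) := Real.sqrt_pos.mpr hp0
  have hqq : √(p : ℝ) * √(p : ℝ) = p := Real.mul_self_sqrt hp0.le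
  have hL0 : 0 < Real.log p := by linarith
  refine le_trans ?_ (ENNReal.log_monotone (le_sparseProb (hW p) hγp.1 hp hb0.le hbp hsp.1
    (δ := √(C / (2 * b * g) / (√(p : ℝ) * Real.log p ^ 2))) (by positivity) ?_ ?_))
  · rw [ENNReal.log_ofReal_of_pos (by positivity)]
    exact EReal.coe_le_coe_iff.mpr hbound
  · rw [Real.sqrt_le_one, div_le_one (by positivity)]
    exact hKp.trans (le_mul_of_one_le_right hq.le (one_le_pow₀ hL))
  · rw [Real.sq_sqrt (by positivity)]
    calc b * (C / (2 * b * g) / (√(p : ℝ) * Real.log p ^ 2) * (γ p ⬝ᵥ γ p))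
        ≤ b * (C / (2 * b * g) / (√(p : ℝ) * Real.log p ^ 2) * g) := by
          gcongr
          exact hγp.2
      _ = C * (√(p : ℝ) / Real.log p ^ 2 / 2) / p := by
          field_simp
          rw [sq, hqq]
      _ ≤ C * logSparsity p / p := by
          gcongr
          linarith [hsp.2]

theorem theorem1 {Ω : ℕ → Type*} [∀ p, MeasurableSpace (Ω p)]
    (P : ∀ p, Measure (Ω p)) [∀ p, IsProbabilityMeasure (P p)]
    (W : ∀ p, Ω p → Fin p → ℝ) (γ : ∀ p, Fin p → ℝ)
    (hW : ∀ p j, MemLp (fun ω => W p ω j) 2 (P p))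
    (heig : ∃ a b : ℝ, 0 < a ∧ ∀ᶠ p in atTop, ∀ t : ℝ,
      Module.End.HasEigenvalue (Matrix.toLin' (secondMoment (P p) (W p))) t → a ≤ t ∧ t ≤ b)
    (hγ : (fun p => ‖WithLp.toLp 2 (γ p)‖) =Θ[atTop] fun _ => (1 : ℝ)) :
    (∀ s : ℕ → ℕ, IsSparsityIndex s → ∀ C : ℝ, ∀ ε : ℝ, 0 < ε → ∀ᶠ p : ℕ in atTop,
      ENNReal.log (sparseProb (P p) (W p) (γ p) (s p) C) ≤
        ((-(1 - ε) * ((p : ℝ) / 4 * Real.log p) : ℝ) : EReal)) ∧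
    (∃ s : ℕ → ℕ, IsSparsityIndex s ∧ ∀ C : ℝ, 0 < C →
      (fun p : ℕ => Real.log (sparseProb (P p) (W p) (γ p) (s p) C).toReal) ~[atTop]
        fun p : ℕ => -((p : ℝ) / 4 * Real.log p)) := by
  obtain ⟨a, b, ha0, hab⟩ := heig
  obtain ⟨g₁, hg₁, hγ₁⟩ := hγ.2.exists_pos
  obtain ⟨g₂, hg₂, hγ₂⟩ := hγ.1.exists_pos
  have hlow : ∀ᶠ p in atTop, (g₁ ^ 2)⁻¹ ≤ γ p ⬝ᵥ γ p := by
    filter_upwards [hγ₁.bound] with p h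
    rw [norm_one, norm_norm] at h
    rw [← norm_toLp_sq, inv_le_iff_one_le_mul₀ (by positivity), ← mul_pow, mul_comm]
    exact one_le_pow₀ h
  have hup : ∀ᶠ p in atTop, γ p ≠ 0 ∧ γ p ⬝ᵥ γ p ≤ g₂ ^ 2 := by
    filter_upwards [hγ₂.bound, hlow] with p h h'
    rw [norm_one, norm_norm, mul_one] at h
    refine ⟨fun h0 => ?_, ?_⟩
    · rw [h0, zero_dotProduct] at h'
      exact absurd h' (not_le.mpr (by positivity))
    · rw [← norm_toLp_sq]
      gcongr
  have hupper := fun (s : ℕ → ℕ) (hs : IsSparsityIndex s) (C ε : ℝ) (hε : 0 < ε) =>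
    eventually_log_sparseProb_le hW ha0 (by positivity)
      (hab.mono fun p h t ht => (h t ht).1) hlow hs C hε
  refine ⟨hupper, logSparsity, isSparsityIndex_logSparsity, fun C hC => ?_⟩
  refine isLittleO_iff.mpr fun ε hε => ?_
  filter_upwards [hupper _ isSparsityIndex_logSparsity C ε hε,
    eventually_le_log_sparseProb_logSparsity hW (b := max b 1) (lt_max_of_lt_right one_pos)
      (by positivity) (hab.mono fun p h t ht => (h t ht).2.trans (le_max_left b 1)) hup hC hε,
    tendsto_log_natCast_atTop.eventually_ge_atTop 0] with p h1 h2 hL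
  -- The finite lower bound excludes probability zero, so the extended logarithm is the real one and
  -- both bounds become real inequalities.
  have h0 : sparseProb (P p) (W p) (γ p) (logSparsity p) C ≠ 0 := fun h => by
    rw [h, ENNReal.log_zero] at h2
    exact EReal.coe_ne_bot _ (le_bot_iff.mp h2)
  rw [ENNReal.log_pos_real h0 (measure_ne_top _ _), EReal.coe_le_coe_iff] at h1 h2
  have hv : 0 ≤ (p : ℝ) / 4 * Real.log p := by positivity
  rw [Pi.sub_apply, norm_neg, Real.norm_eq_abs, Real.norm_eq_abs, abs_of_nonneg hv, abs_le]
  constructor <;> linarith
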